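/- \textbf{Setting.} Let $L,H,d_a,d_x,V,N$ be natural numbers with $d_x=H\,d_a$. The weights of the (softmax-free) $H$-headed self-attention network of depth $L$ and width $d_x$ over a vocabulary $[V]$ are real matrices $W^{K,l,h},W^{Q,l,h},W^{V,l,h}\in\mathbb R^{d_a\times d_x}$, $W^{O,l,h}\in\mathbb R^{d_x\times d_a}$ ($l\in[L]$, $h\in[H]$) and an embedding matrix $M\in\mathbb R^{d_x\times V}$ with columns $M_w$, $w\in[V]$. On input vectors $x^1,\dots,x^n\in\mathbb R^{d_x}$ the network computes $g^{i,0}=x^i$ and $$g^{i,l}=\sum_{h=1}^H W^{O,l,h}\sum_{j=1}^n\big\langle W^{Q,l,h}g^{i,l-1},W^{K,l,h}g^{j,l-1}\big\rangle W^{V,l,h}g^{j,l-1}\qquad(1\le l\le L).$$ For two sentences $S_1=(w_1^1,\dots,w_1^N)$, $S_2=(w_2^1,\dots,w_2^N)$ of words in $[V]$, the in-context representation $y^{(p,i),L,d_x}_{\text{in-context}}$ is the $p$-th entry of $g^{i,L}$ on the $2N$ inputs $M_{w_1^1},\dots,M_{w_1^N},M_{w_2^1},\dots,M_{w_2^N}$.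 Let $\mathcal Z(a,b)$, $a,b\in\mathbb R^{d_x}$, be the $p$-th entry of $g^{i,L}$ on the inputs $M_{w_1^1}\odot a,\dots,M_{w_1^N}\odot a,\,M_{w_2^1}\odot b,\dots,M_{w_2^N}\odot b$, where $\odot$ is the entrywise product. The separation rank $\mathrm{sep}(f)$ of $f:\mathbb R^{d_x}\times\mathbb R^{d_x}\to\mathbb R$ is the least $R\in\mathbb N$ such that $f(a,b)=\sum_{r=1}^R g_r(a)g'_r(b)$ for some functions $g_r,g'_r:\mathbb R^{d_x}\to\mathbb R$ ($\infty$ if there is none). The $\varepsilon$-sequential-separation rank $\varepsilon\text{-seq-sep}\big(y^{(p,i),L,d_x}_{\text{in-context}}\big)$ is the least $R'\in\mathbb N$ with $R'\le\mathrm{sep}(\mathcal Z)$ for which there is $\tilde y:\mathbb R^{d_x}\times\mathbb R^{d_x}\to\mathbb R$ with $\mathrm{sep}(\tilde y)=R'$ and $|\tilde y(a,b)-\mathcal Z(a,b)|\le\varepsilon$ for all $a,b$ ($\infty$ if there is none). \textbf{Theorem 2.} Assume $L>\log_3 d_x$. For every output entry $p\in[d_x]$ and position $i\in[2N]$ there is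 an assignment of the network weights (including $M$) such that, for all sentences $S_1,S_2\in[V]^N$, $$\log\Big[\varepsilon\text{-seq-sep}\big(y^{(p,i),L,d_x}_{\text{in-context}}\big)\Big]=\tilde\Omega(L\cdot d_x)\qquad\text{whenever } 0<\varepsilon=\tilde O\left(\binom{3^L+d_x-1}{3^L}^{-1}\right),$$ where $\tilde O,\tilde\Omega$ omit powers of $\log d_x,\log L,\log H$. Explicitly: for all $C>0$ and $m\in\mathbb N$ there are $c>0$ and $k\in\mathbb N$ such that for all $L,H,d_a,d_x,V,N$ as above with $L>\log_3 d_x$ and all $p\in[d_x]$, $i\in[2N]$ there are weights such that for all $S_1,S_2\in[V]^N$ and all $\varepsilon$ with $0<\varepsilon\le C\,\Lambda^m\binom{3^L+d_x-1}{3^L}^{-1}$, $$\log\Big[\varepsilon\text{-seq-sep}\big(y^{(p,i),L,d_x}_{\text{in-context}}\big)\Big]\ \ge\ \frac{c\,L\,d_x}{\Lambda^k},\qquad \Lambda:=1+\log d_x+\log L+\log H .$$ -/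

import Mathlib

namespace InContext

/-- Key, query, value and output matrices of one `H`-headed self-attention layer of width `dx`
and head dimension `da`. -/
structure LayerWeights (H dx da : ℕ) where
  K : Fin H → Matrix (Fin da) (Fin dx) ℝ
  Q : Fin H → Matrix (Fin da) (Fin dx) ℝ
  V : Fin H → Matrix (Fin da) (Fin dx) ℝ
  O : Fin H → Matrix (Fin dx) (Fin da) ℝ

/-- All learned weights of a depth-`L` network over a vocabulary of size `V`: the weights of the
`L` layers and the vocabulary embedding matrix. -/
structure Weights (L H dx da V : ℕ) where
  layer : Fin L → LayerWeights H dx da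
  emb : Matrix (Fin dx) (Fin V) ℝ

/-- One self-attention layer (no softmax) on a sequence of `n` vectors:
`gⁱ ↦ ∑ₕ W^{O,h} ∑ⱼ ⟨W^{Q,h} gⁱ, W^{K,h} gʲ⟩ W^{V,h} gʲ`. -/
def attnLayer {H dx da n : ℕ} (W : LayerWeights H dx da) (g : Fin n → Fin dx → ℝ) :
    Fin n → Fin dx → ℝ :=
  fun i => ∑ h, (W.O h).mulVec
    (∑ j, (((W.Q h).mulVec (g i)) ⬝ᵥ ((W.K h).mulVec (g j))) • (W.V h).mulVec (g j))

/-- The depth-`L` self-attention stack applied to `n` input vectors. -/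
def attnStack {H dx da n : ℕ} : (L : ℕ) → (Fin L → LayerWeights H dx da) →
    (Fin n → Fin dx → ℝ) → (Fin n → Fin dx → ℝ)
  | 0, _, x => x
  | L + 1, W, x => attnLayer (W (Fin.last L)) (attnStack L (fun l => W l.castSucc) x)

/-- The embedding of the word `w`: the `w`-th column of the vocabulary matrix. -/
def embed {dx V : ℕ} (M : Matrix (Fin dx) (Fin V) ℝ) (w : Fin V) : Fin dx → ℝ :=
  fun p => M p w

/-- The network on a sequence of words. -/
def transformer {L H dx da V n : ℕ} (W : Weights L H dx da V) (w : Fin n → Fin V) :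
    Fin n → Fin dx → ℝ :=
  attnStack L W.layer (fun j => embed W.emb (w j))

/-- The in-context representation: the two sentences are concatenated in the input. -/
def inContext {L H dx da V N : ℕ} (W : Weights L H dx da V) (S₁ S₂ : Fin N → Fin V)
    (i : Fin (N + N)) (p : Fin dx) : ℝ :=
  transformer W (Fin.append S₁ S₂) i p

/-- The in-context representation with the sentence association layer: each use of the embedding
of a word of the first (second) sentence is multiplied entrywise by `a` (by `b`). -/
def inContextAssoc {L H dx da V N : ℕ} (W : Weights L H dx da V) (S₁ S₂ : Fin N → Fin V)
    (i : Fin (N + N)) (p : Fin dx) (a b : Fin dx → ℝ) : ℝ :=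
  attnStack L W.layer
    (Fin.append (fun j => embed W.emb (S₁ j) * a) (fun j => embed W.emb (S₂ j) * b)) i p

/-- With all-ones association vectors the in-context representation is recovered. -/
theorem inContextAssoc_one {L H dx da V N : ℕ} (W : Weights L H dx da V)
    (S₁ S₂ : Fin N → Fin V) (i : Fin (N + N)) (p : Fin dx) :
    inContextAssoc W S₁ S₂ i p 1 1 = inContext W S₁ S₂ i p := by
  unfold inContextAssoc inContext transformer
  congr 2
  funext j
  refine Fin.addCases (fun j => ?_) (fun j => ?_) j
  · rw [Fin.append_left, Fin.append_left, mul_one]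
  · rw [Fin.append_right, Fin.append_right, mul_one]

/-- The separation rank of `y(A, B)`: the least number of products `g(A) * g'(B)` that sum to `y`
(`⊤` if there is no such finite number). -/
noncomputable def sepRank {α β : Type*} (y : α → β → ℝ) : ℕ∞ :=
  sInf {R : ℕ∞ | ∃ n : ℕ, R = n ∧ ∃ (g : Fin n → α → ℝ) (g' : Fin n → β → ℝ),
    ∀ A B, y A B = ∑ r, g r A * g' r B}

/-- The `ε`-separation rank: the least finite separation rank, not exceeding that of `y`, of a
function that is uniformly `ε`-close to `y` (`⊤` if there is none). -/
noncomputable def epsSepRank {α β : Type*} (ε : ℝ) (y : α → β → ℝ) : ℕ∞ :=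
  sInf {R : ℕ∞ | ∃ n : ℕ, R = n ∧ (n : ℕ∞) ≤ sepRank y ∧
    ∃ y' : α → β → ℝ, sepRank y' = n ∧ ∀ A B, |y' A B - y A B| ≤ ε}

/-- The `ε`-sequential-separation rank of the `p`-th entry, at position `i`, of the in-context
representation of `S₁` and `S₂`. -/
noncomputable def epsSeqSep {L H dx da V N : ℕ} (ε : ℝ) (W : Weights L H dx da V)
    (S₁ S₂ : Fin N → Fin V) (i : Fin (N + N)) (p : Fin dx) : ℕ∞ :=
  epsSepRank ε (inContextAssoc W S₁ S₂ i p)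

/-- The logarithmic terms that are omitted in soft asymptotic notation. -/
noncomputable def logTerms (L dx H : ℕ) : ℝ :=
  1 + Real.log dx + Real.log L + Real.log H

end InContext

/-!
The network is jointly homogeneous of degree `3 ^ L` in `(a, b)`, so every uniform approximation
`y'` recovers `𝒵` as the limit of `t ^ (-3 ^ L) * y' (t a) (t b)`: by continuity of the determinant,
a nonsingular matrix of values of `𝒵` bounds the rank of `y'` from below, however large `ε` is.

All layers of the chosen network are equal and pair the coordinate `x` with its reflection
`p + p - x`. Inputs on a monomial curve supported on an arc `p, …, p + J`, reflected for the second
sentence, give the same first-layer value `N * P (τ * σ)` at all positions, where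
`P = 1 + ∑ X ^ e`. The remaining layers take its power `3 ^ (L - 1)`. If the exponents `e` contain
the powers `(b + 1) ^ s` with `s < J`, and `J * b ≤ 3 ^ (L - 1)`, then by expansion in base `b + 1`
this power of `P` has at least `(b + 1) ^ J` monomials. Along geometric progressions in `τ` and `σ`
its values form a Hankel matrix `Vᵀ D V`, with `V` Vandermonde and `D` the diagonal matrix of the
coefficients, so the matrix is nonsingular. For `J` about `dx / 3` the logarithm of the rank is of
order `L * dx` up to `log dx`; for `dx ≤ 3` the coordinate `p` alone suffices.
-/

open Polynomial Filter Topology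
open scoped Matrix

namespace InContext

section SeparationRank

variable {α β : Type*}

theorem rank_le_sepRank {m n : Type*} [Fintype n] (y : α → β → ℝ) (A : m → α) (B : n → β) :
    ((Matrix.of fun i j => y (A i) (B j)).rank : ℕ∞) ≤ sepRank y := by
  refine le_sInf ?_
  rintro _ ⟨k, rfl, g, g', hy⟩
  have hmul : (Matrix.of fun i j => y (A i) (B j)) =
      (Matrix.of fun i r => g r (A i)) * Matrix.of fun r j => g' r (B j) := by
    ext i j
    simp only [Matrix.of_apply, Matrix.mul_apply, hy]
  rw [hmul, Nat.cast_le]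
  calc _ ≤ (Matrix.of fun i r => g r (A i)).rank := Matrix.rank_mul_le_left _ _
    _ ≤ Fintype.card (Fin k) := Matrix.rank_le_card_width _
    _ = k := Fintype.card_fin k

variable [SMul ℝ α] [SMul ℝ β]

/-- Homogeneity of degree `d` of a function of two arguments under scaling both of them at once. -/
def JointlyHomogeneous (d : ℕ) (y : α → β → ℝ) : Prop :=
  ∀ (t : ℝ) (A : α) (B : β), y (t • A) (t • B) = t ^ d * y A B

variable {d : ℕ} {y : α → β → ℝ}

theorem JointlyHomogeneous.tendsto_of_abs_sub_le (hy : JointlyHomogeneous d y) (hd : d ≠ 0)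
    {y' : α → β → ℝ} {ε : ℝ} (hy' : ∀ A B, |y' A B - y A B| ≤ ε) (A : α) (B : β) :
    Tendsto (fun t : ℝ => (t ^ d)⁻¹ * y' (t • A) (t • B)) atTop (𝓝 (y A B)) := by
  have hinv : Tendsto (fun t : ℝ => (t ^ d)⁻¹) atTop (𝓝 0) :=
    tendsto_inv_atTop_zero.comp (tendsto_pow_atTop hd)
  have herr : Tendsto (fun t : ℝ => (t ^ d)⁻¹ * (y' (t • A) (t • B) - y (t • A) (t • B)))
      atTop (𝓝 0) :=
    hinv.zero_mul_isBoundedUnder_le (isBoundedUnder_of ⟨ε, fun _ => hy' _ _⟩)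
  refine (zero_add (y A B) ▸ herr.add_const (y A B)).congr' ?_
  filter_upwards [eventually_gt_atTop 0] with t ht
  rw [hy t A B]
  field_simp
  ring

theorem JointlyHomogeneous.card_le_epsSepRank_of_det_ne_zero (hy : JointlyHomogeneous d y)
    (hd : d ≠ 0) {ι : Type*} [Fintype ι] [DecidableEq ι] (A : ι → α) (B : ι → β)
    (hdet : (Matrix.of fun i j => y (A i) (B j)).det ≠ 0) (ε : ℝ) :
    (Fintype.card ι : ℕ∞) ≤ epsSepRank ε y := by
  refine le_sInf ?_
  rintro _ ⟨n, rfl, -, y', hn, hy'⟩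
  let scaled (t : ℝ) : Matrix ι ι ℝ := Matrix.of fun i j => y' (t • A i) (t • B j)
  have hlim : Tendsto (fun t => ((t ^ d)⁻¹ • scaled t).det) atTop
      (𝓝 (Matrix.of fun i j => y (A i) (B j)).det) :=
    ((continuous_id.matrix_det).tendsto _).comp <| tendsto_pi_nhds.2 fun i =>
      tendsto_pi_nhds.2 fun j => hy.tendsto_of_abs_sub_le hd hy' (A i) (B j)
  obtain ⟨t, ht⟩ := (hlim.eventually_ne hdet).exists
  have hunit : IsUnit (scaled t) := by
    rw [Matrix.det_smul] at ht
    exact (Matrix.isUnit_iff_isUnit_det _).2 (right_ne_zero_of_mul ht).isUnit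
  rw [← Matrix.rank_of_isUnit _ hunit, ← hn]
  exact rank_le_sepRank y' (fun i => t • A i) fun j => t • B j

end SeparationRank

section Hankel

theorem hankel_eval_eq {K : Type*} [CommRing K] (P : K[X]) (q : K) {R : ℕ}
    (hR : P.support.card = R) :
    (Matrix.of fun r s : Fin R => P.eval (q ^ (r + s : ℕ))) =
      (Matrix.vandermonde fun k => q ^ P.support.orderEmbOfFin hR k)ᵀ *
        Matrix.diagonal (fun k => P.coeff (P.support.orderEmbOfFin hR k)) *
        Matrix.vandermonde fun k => q ^ P.support.orderEmbOfFin hR k := by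
  ext r s
  have hsum (f : ℕ → K) : ∑ k ∈ P.support, f k = ∑ k, f (P.support.orderEmbOfFin hR k) := by
    conv_lhs => rw [← Finset.map_orderEmbOfFin_univ P.support hR, Finset.sum_map]
    rfl
  rw [Matrix.of_apply, eval_eq_sum, Polynomial.sum, hsum, Matrix.mul_apply]
  refine Finset.sum_congr rfl fun k _ => ?_
  simp only [Matrix.mul_diagonal, Matrix.transpose_apply, Matrix.vandermonde_apply]
  ring

theorem det_hankel_eval_ne_zero {K : Type*} [CommRing K] [IsDomain K] (P : K[X]) {q : K}
    (hq : Function.Injective fun n : ℕ => q ^ n) {R : ℕ} (hR : P.support.card = R) :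
    (Matrix.of fun r s : Fin R => P.eval (q ^ (r + s : ℕ))).det ≠ 0 := by
  have hvand : (Matrix.vandermonde fun k => q ^ P.support.orderEmbOfFin hR k).det ≠ 0 :=
    Matrix.det_vandermonde_ne_zero_iff.2 (hq.comp (P.support.orderEmbOfFin hR).injective)
  rw [hankel_eval_eq P q hR, Matrix.det_mul, Matrix.det_mul, Matrix.det_transpose,
    Matrix.det_diagonal]
  refine mul_ne_zero (mul_ne_zero hvand (Finset.prod_ne_zero_iff.2 fun k _ => ?_)) hvand
  exact mem_support_iff.1 (P.support.orderEmbOfFin_mem hR k)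

theorem JointlyHomogeneous.card_support_le_epsSepRank {α β : Type*} [SMul ℝ α] [SMul ℝ β]
    {d : ℕ} {y : α → β → ℝ} (hy : JointlyHomogeneous d y) (hd : d ≠ 0) (P : ℕ[X]) {q : ℝ}
    (hq : 1 < q) (A : ℕ → α) (B : ℕ → β) {w w' : ℕ → ℝ} (hw : ∀ r, w r ≠ 0)
    (hw' : ∀ s, w' s ≠ 0) (hval : ∀ r s, y (A r) (B s) = w r * aeval (q ^ (r + s)) P * w' s)
    (ε : ℝ) : (P.support.card : ℕ∞) ≤ epsSepRank ε y := by
  have hsupp : (P.map (algebraMap ℕ ℝ)).support.card = P.support.card := by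
    rw [support_map_of_injective P Nat.cast_injective]
  have hmul : (Matrix.of fun r s : Fin P.support.card => y (A r) (B s)) =
      Matrix.diagonal (fun r : Fin P.support.card => w r) *
        (Matrix.of fun r s : Fin P.support.card =>
          (P.map (algebraMap ℕ ℝ)).eval (q ^ (r + s : ℕ))) *
        Matrix.diagonal fun s : Fin P.support.card => w' s := by
    ext r s
    simp only [Matrix.mul_diagonal, Matrix.diagonal_mul, Matrix.of_apply, hval,
      eval_map_algebraMap]
  rw [← Fintype.card_fin P.support.card]
  refine hy.card_le_epsSepRank_of_det_ne_zero hd (fun r : Fin _ => A r) (fun s => B s) ?_ ε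
  rw [hmul, Matrix.det_mul, Matrix.det_mul, Matrix.det_diagonal, Matrix.det_diagonal]
  exact mul_ne_zero (mul_ne_zero (Finset.prod_ne_zero_iff.2 fun r _ => hw r)
    (det_hankel_eval_ne_zero _ (pow_right_injective₀ (one_pos.trans hq) hq.ne') hsupp))
    (Finset.prod_ne_zero_iff.2 fun s _ => hw' s)

end Hankel

section Support

variable {P Q : ℕ[X]}

theorem add_mem_support_mul {a b : ℕ} (ha : a ∈ P.support) (hb : b ∈ Q.support) :
    a + b ∈ (P * Q).support := by
  rw [mem_support_iff] at *
  rw [coeff_mul, ← Nat.pos_iff_ne_zero]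
  exact Finset.sum_pos' (fun _ _ => Nat.zero_le _)
    ⟨(a, b), Finset.HasAntidiagonal.mem_antidiagonal.2 rfl, Nat.pos_of_ne_zero (mul_ne_zero ha hb)⟩

theorem mul_mem_support_pow (h0 : 0 ∈ P.support) {a : ℕ} (ha : a ∈ P.support) {k n : ℕ}
    (hk : k ≤ n) : k * a ∈ (P ^ n).support := by
  induction n generalizing k with
  | zero => simp [Nat.le_zero.1 hk]
  | succ n ih =>
    rw [pow_succ]
    rcases k with _ | k
    · simpa using add_mem_support_mul (ih (Nat.zero_le n)) h0
    · rw [Nat.succ_mul]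
      exact add_mem_support_mul (ih (Nat.le_of_succ_le_succ hk)) ha

/-- Each `k < (b + 1) ^ J` is a sum of at most `J * b` powers of `b + 1`, by its expansion in
base `b + 1`. -/
theorem range_subset_support_pow {b J n : ℕ} (h0 : 0 ∈ P.support)
    (hpow : ∀ s < J, (b + 1) ^ s ∈ P.support) (hn : J * b ≤ n) :
    Finset.range ((b + 1) ^ J) ⊆ (P ^ n).support := by
  induction J generalizing n with
  | zero =>
    simpa using mul_mem_support_pow h0 h0 (Nat.zero_le n)
  | succ J ih =>
    intro k hk
    rw [Finset.mem_range, pow_succ'] at hk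
    rw [Nat.succ_mul] at hn
    have hdigit : k / (b + 1) ^ J ≤ b :=
      Nat.le_of_lt_succ ((Nat.div_lt_iff_lt_mul (by positivity)).2 hk)
    have hlow : k % (b + 1) ^ J ∈ (P ^ (J * b)).support :=
      ih (fun s hs => hpow s (hs.trans J.lt_succ_self)) le_rfl
        (Finset.mem_range.2 (Nat.mod_lt k (by positivity)))
    have hhigh : k / (b + 1) ^ J * (b + 1) ^ J ∈ (P ^ (n - J * b)).support :=
      mul_mem_support_pow h0 (hpow J J.lt_succ_self) (by omega)
    have hmem := add_mem_support_mul hlow hhigh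
    rwa [Nat.mod_add_div', ← pow_add, Nat.add_sub_of_le (by omega)] at hmem

end Support

section Homogeneity

variable {H dx da n : ℕ}

theorem attnLayer_smul (W : LayerWeights H dx da) (t : ℝ) (g : Fin n → Fin dx → ℝ) :
    attnLayer W (t • g) = t ^ 3 • attnLayer W g := by
  funext i
  simp only [attnLayer, Pi.smul_apply, Finset.smul_sum, ← Matrix.mulVec_smul]
  refine Finset.sum_congr rfl fun h _ => congrArg _ (Finset.sum_congr rfl fun j _ => ?_)
  simp only [Matrix.mulVec_smul, smul_dotProduct, dotProduct_smul, smul_smul, smul_eq_mul]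
  congr 1
  ring

theorem attnStack_smul (L : ℕ) (W : Fin L → LayerWeights H dx da) (t : ℝ)
    (x : Fin n → Fin dx → ℝ) : attnStack L W (t • x) = t ^ 3 ^ L • attnStack L W x := by
  induction L with
  | zero => simp [attnStack]
  | succ L ih => rw [attnStack, attnStack, ih, attnLayer_smul, ← pow_mul, pow_succ]

theorem jointlyHomogeneous_inContextAssoc {L V N : ℕ} (W : Weights L H dx da V)
    (S₁ S₂ : Fin N → Fin V) (i : Fin (N + N)) (p : Fin dx) :
    JointlyHomogeneous (3 ^ L) (inContextAssoc W S₁ S₂ i p) := by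
  intro t a b
  have hinput : Fin.append (fun j => embed W.emb (S₁ j) * (t • a))
      (fun j => embed W.emb (S₂ j) * (t • b)) =
      t • Fin.append (fun j => embed W.emb (S₁ j) * a) (fun j => embed W.emb (S₂ j) * b) := by
    funext j
    refine Fin.addCases (fun j => ?_) (fun j => ?_) j
    · rw [Fin.append_left, Pi.smul_apply, Fin.append_left, mul_smul_comm]
    · rw [Fin.append_right, Pi.smul_apply, Fin.append_right, mul_smul_comm]
  rw [inContextAssoc, hinput, attnStack_smul]
  rfl

end Homogeneity

section BilinearLayer

variable {H da n : ℕ} [NeZero da]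

/-- The layer `gⁱ ↦ (∑ⱼ ⟨M gⁱ, gʲ⟩ gʲₚ) eₚ`. The `h`-th head contributes to the inner product the
coordinates of the `h`-th block of `Fin (H * da)`, so all heads together realize any matrix `M`. -/
def bilinearLayer (M : Matrix (Fin (H * da)) (Fin (H * da)) ℝ) (p : Fin (H * da)) :
    LayerWeights H (H * da) da where
  K h := (1 : Matrix _ _ ℝ).submatrix (fun r => finProdFinEquiv (h, r)) id
  Q h := M.submatrix (fun r => finProdFinEquiv (h, r)) id
  V _ := Matrix.single 0 p 1
  O _ := Matrix.single p 0 1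

theorem attnLayer_bilinearLayer (M : Matrix (Fin (H * da)) (Fin (H * da)) ℝ)
    (p : Fin (H * da)) (g : Fin n → Fin (H * da) → ℝ) (i : Fin n) :
    attnLayer (bilinearLayer M p) g i = Pi.single p (∑ j, (M *ᵥ g i ⬝ᵥ g j) * g j p) := by
  have hdot (v v' : Fin (H * da) → ℝ) : v ⬝ᵥ v' =
      ∑ h, (fun r : Fin da => v (finProdFinEquiv (h, r))) ⬝ᵥ
        fun r => v' (finProdFinEquiv (h, r)) := by
    simp only [dotProduct]
    rw [← finProdFinEquiv.sum_comp, Fintype.sum_prod_type]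
  have hQ (h : Fin H) (v : Fin (H * da) → ℝ) : (bilinearLayer M p).Q h *ᵥ v =
      fun r : Fin da => (M *ᵥ v) (finProdFinEquiv (h, r)) := rfl
  have hK (h : Fin H) (v : Fin (H * da) → ℝ) : (bilinearLayer M p).K h *ᵥ v =
      fun r : Fin da => v (finProdFinEquiv (h, r)) := by
    funext r
    exact congrFun (Matrix.one_mulVec v) _
  have hOV (h : Fin H) (v : Fin (H * da) → ℝ) :
      (bilinearLayer M p).O h *ᵥ ((bilinearLayer M p).V h *ᵥ v) = v p • Pi.single p 1 := by
    ext x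
    simp [bilinearLayer, Matrix.single_mulVec, Pi.single_apply,
      Function.update_apply]
  simp only [attnLayer, hQ, hK, Matrix.mulVec_sum, Matrix.mulVec_smul, hOV]
  rw [Finset.sum_comm]
  simp only [← Finset.sum_smul, ← hdot]
  simp only [← Pi.single_smul, smul_eq_mul, mul_one]
  exact (map_sum (AddMonoidHom.single (fun _ : Fin (H * da) => ℝ) p) _ _).symm

theorem iterate_attnLayer_bilinearLayer_single {M : Matrix (Fin (H * da)) (Fin (H * da)) ℝ}
    {p : Fin (H * da)} (hM : M p p = 1) (u : Fin n → ℝ) (L : ℕ) :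
    (attnLayer (bilinearLayer M p))^[L] (fun j => Pi.single p (u j)) =
      fun i => Pi.single p (u i * (∑ j, u j ^ 2) ^ (3 ^ L / 2)) := by
  induction L with
  | zero => simp
  | succ L ih =>
    have hdegree : 3 ^ (L + 1) / 2 = 3 * (3 ^ L / 2) + 1 := by
      have := Nat.two_mul_div_two_add_one_of_odd (Odd.pow (n := L) (by decide : Odd 3))
      omega
    funext i
    rw [Function.iterate_succ_apply', ih, attnLayer_bilinearLayer]
    simp only [Matrix.mulVec_single, dotProduct_single, Pi.single_eq_same, Pi.smul_apply,
      Matrix.col_apply, hM, MulOpposite.smul_eq_mul_unop, MulOpposite.unop_op, one_mul, hdegree]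
    set q := ∑ j, u j ^ 2 with hq
    have hterm (j : Fin n) : u i * q ^ (3 ^ L / 2) * (u j * q ^ (3 ^ L / 2)) *
        (u j * q ^ (3 ^ L / 2)) = u i * q ^ (3 * (3 ^ L / 2)) * u j ^ 2 := by ring
    rw [Finset.sum_congr rfl fun j _ => hterm j, ← Finset.mul_sum, ← hq, pow_succ, mul_assoc]

end BilinearLayer

section PermWeights

theorem permMatrix_apply_self_of_fixed {ι : Type*} [DecidableEq ι] {π : Equiv.Perm ι} {p : ι}
    (hp : π p = p) : π.permMatrix ℝ p p = 1 := by
  simp [Equiv.Perm.permMatrix, PEquiv.toMatrix_apply, hp]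

variable {H da : ℕ} [NeZero da]

/-- The network whose layers all equal `bilinearLayer` for the matrix of the permutation `π`, with
all words embedded as the all-ones vector. -/
def permWeights (L V : ℕ) (π : Equiv.Perm (Fin (H * da))) (p : Fin (H * da)) :
    Weights L H (H * da) da V where
  layer _ := bilinearLayer (π.permMatrix ℝ) p
  emb := Matrix.of fun _ _ => 1

theorem attnStack_const {H dx da n : ℕ} (L : ℕ) (W : LayerWeights H dx da)
    (x : Fin n → Fin dx → ℝ) : attnStack L (fun _ => W) x = (attnLayer W)^[L] x := by
  induction L with
  | zero => rfl
  | succ L ih => rw [attnStack, ih, Function.iterate_succ_apply']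

variable {L V N : ℕ} {π : Equiv.Perm (Fin (H * da))} {p : Fin (H * da)}

theorem inContextAssoc_permWeights (S₁ S₂ : Fin N → Fin V) (i : Fin (N + N))
    (a b : Fin (H * da) → ℝ) :
    inContextAssoc (permWeights L V π p) S₁ S₂ i p a b =
      (attnLayer (bilinearLayer (π.permMatrix ℝ) p))^[L]
        (Fin.append (fun _ => a) fun _ => b) i p := by
  have hemb (v : Fin V) : embed (permWeights L V π p).emb v = 1 := rfl
  simp only [inContextAssoc, hemb, one_mul]
  rw [← attnStack_const]
  rfl

theorem sum_append_const {γ M : Type*} [AddCommMonoid M] (a b : γ) (f : γ → M) :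
    ∑ j, f (Fin.append (fun _ : Fin N => a) (fun _ : Fin N => b) j) = N • (f a + f b) := by
  simp only [Fin.sum_univ_add, Fin.append_left, Fin.append_right, Finset.sum_const,
    Finset.card_univ, Fintype.card_fin, smul_add]

theorem inContextAssoc_permWeights_single (hp : π p = p) (S₁ S₂ : Fin N → Fin V)
    (i : Fin (N + N)) (α β : ℝ) :
    inContextAssoc (permWeights L V π p) S₁ S₂ i p (Pi.single p α) (Pi.single p β) =
      Fin.append (fun _ : Fin N => α) (fun _ => β) i *
        (N * (α ^ 2 + β ^ 2)) ^ (3 ^ L / 2) := by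
  have hinput : Fin.append (fun _ : Fin N => (Pi.single p α : Fin (H * da) → ℝ))
      (fun _ : Fin N => Pi.single p β) =
      fun j => Pi.single p (Fin.append (fun _ : Fin N => α) (fun _ => β) j) := by
    funext j
    refine Fin.addCases (fun j => ?_) (fun j => ?_) j <;> simp [-Fin.natAdd_eq_addNat]
  rw [inContextAssoc_permWeights, hinput,
    iterate_attnLayer_bilinearLayer_single (permMatrix_apply_self_of_fixed hp),
    sum_append_const α β (· ^ 2), nsmul_eq_mul]
  exact Pi.single_eq_same _ _

theorem three_pow_half_add_one_le_epsSeqSep_permWeights (hp : π p = p) (S₁ S₂ : Fin N → Fin V)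
    (i : Fin (N + N)) (ε : ℝ) :
    ((3 ^ L / 2 + 1 : ℕ) : ℕ∞) ≤ epsSeqSep ε (permWeights L V π p) S₁ S₂ i p := by
  have hN : (N : ℝ) ≠ 0 := by
    have := i.pos
    exact_mod_cast (by omega : N ≠ 0)
  obtain ⟨w, w', hw, hw', hi⟩ : ∃ w w' : ℕ → ℝ, (∀ r, w r ≠ 0) ∧ (∀ s, w' s ≠ 0) ∧ ∀ r s,
      Fin.append (fun _ : Fin N => (2 ^ r : ℝ)⁻¹) (fun _ => 2 ^ s) i = w r * w' s := by
    refine Fin.addCases (fun j => ?_) (fun j => ?_) i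
    · exact ⟨fun r => (2 ^ r)⁻¹, fun _ => 1, by simp, by simp, by simp⟩
    · exact ⟨fun _ => 1, fun s => 2 ^ s, by simp, by simp, by simp [-Fin.natAdd_eq_addNat]⟩
  have hsupport : 3 ^ L / 2 + 1 ≤ (((1 + X) ^ (3 ^ L / 2) : ℕ[X])).support.card := by
    simpa using Finset.card_le_card (range_subset_support_pow (P := 1 + X) (b := 3 ^ L / 2)
      (J := 1) (by simp) (by simp [coeff_one]) (one_mul _).le)
  refine (Nat.cast_le.2 hsupport).trans <|
    (jointlyHomogeneous_inContextAssoc _ S₁ S₂ i p).card_support_le_epsSepRank (by positivity) _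
      (q := 4) (by norm_num) (fun r => Pi.single p (2 ^ r)⁻¹) (fun s => Pi.single p (2 ^ s))
      (w := fun r => w r * (N * (4 ^ r)⁻¹) ^ (3 ^ L / 2)) (fun r => ?_) hw' (fun r s => ?_) ε
  · exact mul_ne_zero (hw r) (pow_ne_zero _ (mul_ne_zero hN (by positivity)))
  · have hfactor : ((2 ^ r : ℝ)⁻¹) ^ 2 + (2 ^ s) ^ 2 = (4 ^ r)⁻¹ * (1 + 4 ^ (r + s)) := by
      have hfour (k : ℕ) : (4 : ℝ) ^ k = (2 ^ k) ^ 2 := by rw [← pow_mul, pow_mul']; norm_num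
      rw [hfour, hfour]
      field_simp
      ring
    rw [inContextAssoc_permWeights_single hp, hi, hfactor, ← mul_assoc, mul_pow]
    simp only [map_pow, map_add, map_one, aeval_X]
    ring

end PermWeights

section MonomialVector

variable {ι : Type*} [DecidableEq ι]

/-- The point with parameter `τ` on the monomial curve with exponents `e` in the coordinates of
`T`. -/
def monomialVector (T : Finset ι) (e : ι → ℕ) (τ : ℝ) : ι → ℝ :=
  fun x => if x ∈ T then τ ^ e x else 0

variable {T : Finset ι} {e : ι → ℕ} {p : ι}

theorem monomialVector_apply_of_exponent_eq_zero (hpT : p ∈ T) (hep : e p = 0) (τ : ℝ) :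
    monomialVector T e τ p = 1 := by
  simp [monomialVector, hpT, hep]

variable [Fintype ι] {π : Equiv.Perm ι}

theorem monomialVector_dotProduct_monomialVector (τ σ : ℝ) :
    monomialVector T e τ ⬝ᵥ monomialVector T e σ =
      aeval (τ * σ) (∑ x ∈ T, X ^ e x : ℕ[X]) := by
  simp [dotProduct, monomialVector, ite_mul, mul_ite, mul_pow, Finset.sum_ite_mem]

theorem monomialVector_comp_dotProduct_monomialVector (hp : π p = p) (hpT : p ∈ T)
    (hep : e p = 0) (hT : ∀ x ∈ T, π x ∈ T → x = p) (τ : ℝ) :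
    (monomialVector T e τ ∘ π) ⬝ᵥ monomialVector T e τ = 1 := by
  rw [dotProduct, Finset.sum_eq_single p]
  · simp [hp, monomialVector_apply_of_exponent_eq_zero hpT hep]
  · intro x _ hx
    have : x ∉ T ∨ π x ∉ T := not_and_or.1 fun h => hx (hT x h.1 h.2)
    rcases this with h | h <;> simp [monomialVector, h]
  · simp

end MonomialVector

section MonomialInput

variable {H da N : ℕ} [NeZero da] {π : Equiv.Perm (Fin (H * da))} {p : Fin (H * da)}
  {T : Finset (Fin (H * da))} {e : Fin (H * da) → ℕ}

/-- A pairing `π` that meets `T` only in `p` makes every query of a sentence vanish on the keys of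
the same sentence, up to the contribution `1` of `p`, so all positions carry the same value. -/
theorem attnLayer_bilinearLayer_monomialVector (hp : π p = p) (hinv : π * π = 1)
    (hpT : p ∈ T) (hep : e p = 0) (hT : ∀ x ∈ T, π x ∈ T → x = p) (τ σ : ℝ) :
    attnLayer (bilinearLayer (π.permMatrix ℝ) p) (Fin.append
      (fun _ : Fin N => monomialVector T e τ) fun _ : Fin N => monomialVector T e σ ∘ π) =
      fun _ => Pi.single p (N * aeval (τ * σ) (1 + ∑ x ∈ T, X ^ e x : ℕ[X])) := by
  have hval (ρ : ℝ) : monomialVector T e ρ p = 1 :=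
    monomialVector_apply_of_exponent_eq_zero hpT hep ρ
  have hself (ρ : ℝ) : (monomialVector T e ρ ∘ π) ⬝ᵥ monomialVector T e ρ = 1 :=
    monomialVector_comp_dotProduct_monomialVector hp hpT hep hT ρ
  have hinv' (ρ : ℝ) : (monomialVector T e ρ ∘ π) ∘ π = monomialVector T e ρ := by
    rw [Function.comp_assoc, ← Equiv.Perm.coe_mul, hinv, Equiv.Perm.coe_one, Function.comp_id]
  have hcross : (monomialVector T e τ ∘ π) ⬝ᵥ (monomialVector T e σ ∘ π) =
      monomialVector T e τ ⬝ᵥ monomialVector T e σ :=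
    comp_equiv_dotProduct_comp_equiv _ _ π
  have hcomm := dotProduct_comm (monomialVector T e σ) (monomialVector T e τ)
  funext i
  rw [attnLayer_bilinearLayer]
  congr 1
  rw [sum_append_const (monomialVector T e τ) (monomialVector T e σ ∘ π)
    (fun v => (π.permMatrix ℝ *ᵥ _ ⬝ᵥ v) * v p), Matrix.permMatrix_mulVec]
  refine Fin.addCases (fun j => ?_) (fun j => ?_) i
  · rw [Fin.append_left, hself, hcross, monomialVector_dotProduct_monomialVector]
    simp [hp, hval, mul_add]
  · rw [Fin.append_right, hinv', hcomm, dotProduct_comm (monomialVector T e σ), hself,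
      monomialVector_dotProduct_monomialVector]
    simp [hp, hval, mul_add, add_comm]

theorem inContextAssoc_permWeights_monomialVector {V : ℕ} (hp : π p = p) (hinv : π * π = 1)
    (hpT : p ∈ T) (hep : e p = 0) (hT : ∀ x ∈ T, π x ∈ T → x = p) (l : ℕ)
    (S₁ S₂ : Fin N → Fin V) (i : Fin (N + N)) (τ σ : ℝ) :
    inContextAssoc (permWeights (l + 1) V π p) S₁ S₂ i p (monomialVector T e τ)
      (monomialVector T e σ ∘ π) =
      (N + N) ^ (3 ^ l / 2) * N ^ 3 ^ l *
        aeval (τ * σ) ((1 + ∑ x ∈ T, X ^ e x : ℕ[X]) ^ 3 ^ l) := by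
  have hodd : 2 * (3 ^ l / 2) + 1 = 3 ^ l :=
    Nat.two_mul_div_two_add_one_of_odd (Odd.pow (by decide))
  rw [inContextAssoc_permWeights, Function.iterate_succ_apply,
    attnLayer_bilinearLayer_monomialVector hp hinv hpT hep hT,
    iterate_attnLayer_bilinearLayer_single (permMatrix_apply_self_of_fixed hp), map_pow]
  simp only [Pi.single_eq_same, Finset.sum_const, Finset.card_univ, Fintype.card_fin, nsmul_eq_mul,
    Nat.cast_add]
  generalize aeval (τ * σ) (1 + ∑ x ∈ T, X ^ e x : ℕ[X]) = v
  calc _ = ((N : ℝ) + N) ^ (3 ^ l / 2) * (N * v) ^ (2 * (3 ^ l / 2) + 1) := by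
        rw [mul_pow ((N : ℝ) + N), ← pow_mul]
        ring
    _ = _ := by rw [hodd, mul_pow, mul_assoc]

end MonomialInput

section Arc

variable {d : ℕ} (p : Fin d)

/-- The exponent `0` at `p` and `B ^ s` at the cyclic shift `p + (s + 1)`. -/
def arcExponent (B : ℕ) (x : Fin d) : ℕ := if x = p then 0 else B ^ ((x - p : Fin d).val - 1)

theorem arcExponent_self (B : ℕ) : arcExponent p B p = 0 := if_pos rfl

/-- The coordinates `p, p + 1, …, p + J`, taken cyclically. -/
def arc (J : ℕ) : Finset (Fin d) := {x | (x - p : Fin d).val ≤ J}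

variable [NeZero d]

theorem self_mem_arc (J : ℕ) : p ∈ arc p J := by
  simp [arc]

theorem eq_of_mem_arc_of_reflection_mem_arc {J : ℕ} (hJ : 2 * J < d) {x : Fin d}
    (hx : x ∈ arc p J) (hx' : Equiv.subLeft (p + p) x ∈ arc p J) : x = p := by
  have hx : (x - p).val ≤ J := by simpa only [arc, Finset.mem_filter_univ] using hx
  have hneg : Equiv.subLeft (p + p) x - p = -(x - p) := by
    rw [Equiv.subLeft_apply]
    abel
  have hx' : (-(x - p)).val ≤ J := by simpa only [arc, Finset.mem_filter_univ, hneg] using hx'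
  have hsum : ((x - p).val + (-(x - p)).val) % d = 0 := by
    rw [← Fin.val_add, add_neg_cancel, Fin.val_zero]
  rw [Nat.mod_eq_of_lt (by omega)] at hsum
  exact sub_eq_zero.1 (Fin.ext (by rw [Fin.val_zero]; omega))

theorem exists_mem_arc_arcExponent_eq {J s : ℕ} (hJ : J < d) (hs : s < J) (B : ℕ) :
    ∃ x ∈ arc p J, arcExponent p B x = B ^ s := by
  have hval : ((p + Fin.ofNat d (s + 1)) - p : Fin d).val = s + 1 := by
    rw [add_sub_cancel_left, Fin.val_ofNat, Nat.mod_eq_of_lt (by omega)]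
  refine ⟨p + Fin.ofNat d (s + 1), ?_, ?_⟩
  · rw [arc, Finset.mem_filter_univ, hval]
    omega
  · have hne : p + Fin.ofNat d (s + 1) ≠ p := fun h => by
      rw [h, sub_self, Fin.val_zero] at hval
      omega
    rw [arcExponent, if_neg hne, hval, Nat.add_sub_cancel]

end Arc

theorem mem_support_one_add_sum_X_pow {ι : Type*} {T : Finset ι} {e : ι → ℕ} {x : ι} (hx : x ∈ T) :
    e x ∈ (1 + ∑ x ∈ T, X ^ e x : ℕ[X]).support := by
  have hsum : 0 < ∑ y ∈ T, (X ^ e y : ℕ[X]).coeff (e x) :=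
    Finset.sum_pos' (fun _ _ => Nat.zero_le _) ⟨x, hx, by simp⟩
  rw [mem_support_iff, coeff_add, finsetSum_coeff]
  omega

theorem pow_le_epsSeqSep_permWeights {H da V N l J b : ℕ} [NeZero da] [NeZero (H * da)]
    (p : Fin (H * da)) (hJ : 2 * J < H * da) (hb : J * b ≤ 3 ^ l) (S₁ S₂ : Fin N → Fin V)
    (i : Fin (N + N)) (ε : ℝ) :
    (((b + 1) ^ J : ℕ) : ℕ∞) ≤
      epsSeqSep ε (permWeights (l + 1) V (Equiv.subLeft (p + p)) p) S₁ S₂ i p := by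
  set π := Equiv.subLeft (p + p) with hπ
  have hp : π p = p := by rw [hπ, Equiv.subLeft_apply, add_sub_cancel_right]
  have hinv : π * π = 1 := Equiv.ext fun x => by simp [hπ]
  have hN : (N : ℝ) ≠ 0 := by
    have := i.pos
    exact_mod_cast (by omega : N ≠ 0)
  set P : ℕ[X] := 1 + ∑ x ∈ arc p J, X ^ arcExponent p (b + 1) x
  have hrange : Finset.range ((b + 1) ^ J) ⊆ (P ^ 3 ^ l).support := by
    refine range_subset_support_pow (by simp [P]) (fun s hs => ?_) hb
    obtain ⟨x, hx, hxs⟩ := exists_mem_arc_arcExponent_eq p (by omega) hs (b + 1)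
    exact hxs ▸ mem_support_one_add_sum_X_pow hx
  have hcard : (b + 1) ^ J ≤ (P ^ 3 ^ l).support.card := by
    simpa only [Finset.card_range] using Finset.card_le_card hrange
  refine (Nat.cast_le.2 hcard).trans <|
    (jointlyHomogeneous_inContextAssoc _ S₁ S₂ i p).card_support_le_epsSepRank (by positivity) _
      one_lt_two (fun r => monomialVector (arc p J) (arcExponent p (b + 1)) (2 ^ r))
      (fun s => monomialVector (arc p J) (arcExponent p (b + 1)) (2 ^ s) ∘ π)
      (w := fun _ => (N + N) ^ (3 ^ l / 2) * N ^ 3 ^ l) (w' := fun _ => 1)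
      (fun _ => ?_) (fun _ => one_ne_zero) (fun r s => ?_) ε
  · exact mul_ne_zero (pow_ne_zero _ (by rwa [Ne, add_self_eq_zero])) (pow_ne_zero _ hN)
  · rw [inContextAssoc_permWeights_monomialVector hp hinv (self_mem_arc p J) (arcExponent_self p _)
      (fun x => eq_of_mem_arc_of_reflection_mem_arc p hJ), pow_add, mul_one]

section Logarithm

theorem coe_le_log_of_le {x : ℝ} {R : ℕ} {M : ℕ∞} (hR : 0 < R) (hx : x ≤ Real.log R)
    (hM : (R : ℕ∞) ≤ M) : (x : EReal) ≤ ENNReal.log (M : ENNReal) :=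
  calc (x : EReal) ≤ (Real.log R : EReal) := EReal.coe_le_coe_iff.2 hx
    _ = ENNReal.log (ENNReal.ofReal R) :=
      (ENNReal.log_ofReal_of_pos (Nat.cast_pos.2 hR)).symm
    _ ≤ ENNReal.log M := ENNReal.log_monotone (by
      rw [ENNReal.ofReal_natCast]
      exact_mod_cast hM)

variable {L d : ℕ}

theorem two_pow_le_three_pow_half_add_one (L : ℕ) : 2 ^ L ≤ 3 ^ L / 2 + 1 := by
  induction L with
  | zero => norm_num
  | succ L ih =>
    rw [pow_succ, pow_succ]
    have := Nat.one_le_pow L 3 (by norm_num)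
    omega

theorem div_one_add_log_le_log_three_pow_half (hd : d ≤ 3) :
    (L : ℝ) * d / (12 * (1 + Real.log d)) ≤ Real.log (3 ^ L / 2 + 1 : ℕ) := by
  have hd' : (d : ℝ) ≤ 3 := by exact_mod_cast hd
  have := Real.log_natCast_nonneg d
  calc (L : ℝ) * d / (12 * (1 + Real.log d)) ≤ L * 3 / 12 := by gcongr; linarith
    _ ≤ L * Real.log 2 := by nlinarith [Real.log_two_gt_d9, L.cast_nonneg (α := ℝ)]
    _ = Real.log (2 ^ L : ℕ) := by rw [Nat.cast_pow, Nat.cast_ofNat, Real.log_pow]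
    _ ≤ Real.log (3 ^ L / 2 + 1 : ℕ) := Real.log_le_log (by positivity)
      (Nat.cast_le.2 (two_pow_le_three_pow_half_add_one L))

theorem le_two_mul_log_mul_one_add_log {B : ℕ} (hB : 2 ≤ B) (hd : 0 < d) (hBd : 3 ^ L ≤ B * d) :
    (L : ℝ) ≤ 2 * Real.log B * (1 + Real.log d) := by
  have hBpos : (0 : ℝ) < B := by exact_mod_cast two_pos.trans_le hB
  have hdpos : (0 : ℝ) < d := Nat.cast_pos.2 hd
  have hlogB : 1 / 2 ≤ Real.log B := by
    have : Real.log 2 ≤ Real.log B := Real.log_le_log two_pos (by exact_mod_cast hB)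
    linarith [Real.log_two_gt_d9]
  have hlog3 : 1 ≤ Real.log 3 := by
    rw [Real.le_log_iff_exp_le (by norm_num)]
    linarith [Real.exp_one_lt_d9]
  calc (L : ℝ) ≤ L * Real.log 3 := le_mul_of_one_le_right L.cast_nonneg hlog3
    _ = Real.log (3 ^ L) := (Real.log_pow _ _).symm
    _ ≤ Real.log (B * d) := Real.log_le_log (by positivity) (by exact_mod_cast hBd)
    _ = Real.log B + Real.log d := Real.log_mul hBpos.ne' hdpos.ne'
    _ ≤ 2 * Real.log B * (1 + Real.log d) := by nlinarith [Real.log_natCast_nonneg d]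

theorem div_one_add_log_le_log_pow {B J : ℕ} (hB : 2 ≤ B) (hd : 0 < d) (hBd : 3 ^ L ≤ B * d)
    (hJ : d ≤ 6 * J) :
    (L : ℝ) * d / (12 * (1 + Real.log d)) ≤ Real.log (B ^ J : ℕ) := by
  have := Real.log_natCast_nonneg d
  have hL := le_two_mul_log_mul_one_add_log hB hd hBd
  have hJ' : (d : ℝ) ≤ 6 * J := by exact_mod_cast hJ
  rw [Nat.cast_pow, Real.log_pow, div_le_iff₀ (by positivity)]
  calc (L : ℝ) * d ≤ 2 * Real.log B * (1 + Real.log d) * (6 * J) := by gcongr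
    _ = J * Real.log B * (12 * (1 + Real.log d)) := by ring

theorem div_logTerms_le (L d H : ℕ) :
    1 / 12 * ((L : ℝ) * d) / logTerms L d H ^ 1 ≤ L * d / (12 * (1 + Real.log d)) := by
  have hlogs : 1 + Real.log d ≤ logTerms L d H := by
    have hL := Real.log_natCast_nonneg L
    have hH := Real.log_natCast_nonneg H
    rw [logTerms]
    linarith
  have := Real.log_natCast_nonneg d
  calc 1 / 12 * ((L : ℝ) * d) / logTerms L d H ^ 1 = L * d / (12 * logTerms L d H) := by
        rw [pow_one]; ring
    _ ≤ L * d / (12 * (1 + Real.log d)) := by gcongr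

end Logarithm

section LowerBound

variable {L H da V N : ℕ} [NeZero da] [NeZero (H * da)] (p : Fin (H * da))
  (S₁ S₂ : Fin N → Fin V) (i : Fin (N + N)) (ε : ℝ)

theorem div_one_add_log_le_log_epsSeqSep_of_le_three (hd : H * da ≤ 3) :
    ((L * (H * da : ℕ) / (12 * (1 + Real.log (H * da : ℕ))) : ℝ) : EReal) ≤
      ENNReal.log (epsSeqSep ε (permWeights L V (Equiv.subLeft (p + p)) p) S₁ S₂ i p : ℕ∞) :=
  coe_le_log_of_le (Nat.succ_pos _) (div_one_add_log_le_log_three_pow_half hd)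
    (three_pow_half_add_one_le_epsSeqSep_permWeights (add_sub_cancel_right p p) S₁ S₂ i ε)

theorem div_one_add_log_le_log_epsSeqSep_of_three_lt (hd : 3 < H * da) (hL : H * da ≤ 3 ^ L) :
    ((L * (H * da : ℕ) / (12 * (1 + Real.log (H * da : ℕ))) : ℝ) : EReal) ≤
      ENNReal.log (epsSeqSep ε (permWeights L V (Equiv.subLeft (p + p)) p) S₁ S₂ i p : ℕ∞) := by
  obtain ⟨l, rfl⟩ : ∃ l, L = l + 1 := Nat.exists_eq_succ_of_ne_zero (by rintro rfl; omega)
  rw [pow_succ] at hL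
  set J := (H * da - 1) / 3
  have hb : 1 ≤ 3 ^ l / J := (Nat.one_le_div_iff (by omega)).2 (by omega)
  have hBd : 3 ^ (l + 1) ≤ (3 ^ l / J + 1) * (H * da) := by
    have hlt : 3 ^ l < J * (3 ^ l / J + 1) := Nat.lt_mul_div_succ _ (by omega)
    calc 3 ^ (l + 1) ≤ (3 ^ l / J + 1) * (3 * J) := by rw [pow_succ]; linarith
      _ ≤ (3 ^ l / J + 1) * (H * da) := Nat.mul_le_mul_left _ (by omega)
  exact coe_le_log_of_le (by positivity)
    (div_one_add_log_le_log_pow (by omega) p.pos hBd (by omega))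
    (pow_le_epsSeqSep_permWeights p (by omega) (Nat.mul_div_le _ _) S₁ S₂ i ε)

end LowerBound

end InContext

theorem theorem2_general (L H dx da V : ℕ) (hdx : dx = H * da) (hL : Real.logb 3 dx ≤ L)
    (p : Fin dx) :
    ∃ W : InContext.Weights L H dx da V, ∀ (N : ℕ) (S₁ S₂ : Fin N → Fin V) (i : Fin (N + N))
      (ε : ℝ), ((L * dx / (12 * (1 + Real.log dx)) : ℝ) : EReal) ≤
        ENNReal.log ((InContext.epsSeqSep ε W S₁ S₂ i p : ℕ∞) : ENNReal) := by
  subst hdx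
  have : NeZero (H * da) := ⟨p.pos.ne'⟩
  have : NeZero da := ⟨right_ne_zero_of_mul p.pos.ne'⟩
  have hwidth : H * da ≤ 3 ^ L := by
    rw [Real.logb_le_iff_le_rpow (by norm_num) (by exact_mod_cast p.pos), Real.rpow_natCast] at hL
    exact_mod_cast hL
  refine ⟨InContext.permWeights L V (Equiv.subLeft (p + p)) p, fun N S₁ S₂ i ε => ?_⟩
  rcases le_or_gt (H * da) 3 with hd | hd
  · exact InContext.div_one_add_log_le_log_epsSeqSep_of_le_three p S₁ S₂ i ε hd
  · exact InContext.div_one_add_log_le_log_epsSeqSep_of_three_lt p S₁ S₂ i ε hd hwidth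

theorem theorem2 :
    -- `C` and `m` are the constant and the power of logarithms hidden in the bound on `ε`,
    -- `c` and `k` those hidden in the lower bound on the rank
    ∀ (C : ℝ) (m : ℕ), 0 < C → ∃ (c : ℝ) (k : ℕ), 0 < c ∧
      ∀ (L H dx da V N : ℕ), dx = H * da → Real.logb 3 (dx : ℝ) < (L : ℝ) →
      ∀ (p : Fin dx) (i : Fin (N + N)),
      ∃ W : InContext.Weights L H dx da V,
        ∀ (S₁ S₂ : Fin N → Fin V) (ε : ℝ), 0 < ε →
          ε ≤ C * InContext.logTerms L dx H ^ m *
            ((Nat.choose (3 ^ L + dx - 1) (3 ^ L) : ℕ) : ℝ)⁻¹ →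
          ((c * ((L : ℝ) * (dx : ℝ)) / InContext.logTerms L dx H ^ k : ℝ) : EReal) ≤
            ENNReal.log ((InContext.epsSeqSep ε W S₁ S₂ i p : ℕ∞) : ENNReal) := by
  intro C m _
  refine ⟨1 / 12, 1, by norm_num, fun L H dx da V N hdx hL p i => ?_⟩
  obtain ⟨W, hW⟩ := theorem2_general L H dx da V hdx hL.le p
  exact ⟨W, fun S₁ S₂ ε _ _ =>
    (EReal.coe_le_coe_iff.2 (InContext.div_logTerms_le L dx H)).trans (hW N S₁ S₂ i ε)⟩
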